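/- Let $M$ be a finite-dimensional smooth manifold (Hausdorff, without boundary), let $T^*M$ be its cotangent bundle with projection $\pi : T^*M \to M$, and let $\Theta$ be the tautological one-form on $T^*M$, $\langle \Theta(q,p), w\rangle = \langle p, T\pi\, w\rangle$ for $w \in T_{(q,p)}T^*M$. For a smooth vector field $v$ on $M$ with (local) flow $\Phi_\epsilon$, the cotangent lift $\widehat{v}$ is the vector field on $T^*M$ that generates the cotangent lifted flow, $$\widehat{v}(z) = \frac{d}{d\epsilon}\Big|_{\epsilon=0} (\Phi_{-\epsilon})^*(z), \qquad (\Phi_{-\epsilon})^*(q,p) = \big(\Phi_\epsilon(q),\; p\circ T_{\Phi_\epsilon(q)}\Phi_{-\epsilon}\big).$$ Let $f$ and $g$ be smooth vector fields on $M$ such that $g$ is a symmetry of the ODE $\dot q = f(q)$, i.e. $[g,f] = 0$. Then $\widehat{g}$ is a symmetry of the adjoint system $\dot z = \widehat{f}(z)$ on $T^*M$, i.e. $\widehat{g}$ is a smooth vector field on $T^*M$ with $[\widehat{g},\widehat{f}] = 0$. Moreover, the function $z \mapsto \langle \Theta(z), \widehat{g}(z)\rangle$ on $T^*M$ is preserved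 along the flow of $\widehat{f}$: it is constant along every integral curve $\gamma : J \to T^*M$ of $\widehat{f}$, where $J\subseteq\mathbb{R}$ is an interval. -/

import Mathlib

open Bundle Set
open scoped Manifold ContDiff Topology

noncomputable section

namespace AdjointSystem

variable {E : Type*} [NormedAddCommGroup E] [NormedSpace ℝ E]
  {H : Type*} [TopologicalSpace H] (I : ModelWithCorners ℝ E H)
  {M : Type*} [TopologicalSpace M] [ChartedSpace H M]

/-- The cotangent space `T*_q M`. -/
abbrev CotangentSpace (q : M) : Type _ := TangentSpace I q →L[ℝ] ℝ

/-- The cotangent bundle `T*M`: its points are the pairs `z = ⟨q, p⟩` with `p ∈ T*_q M`. Its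
topology and its atlas are those of Mathlib's bundle of continuous linear maps. -/
abbrev CotangentBundle (M : Type*) [TopologicalSpace M] [ChartedSpace H M]
    [IsManifold I 1 M] : Type _ :=
  TotalSpace (E →L[ℝ] ℝ) (fun q : M ↦ TangentSpace I q →L[ℝ] ℝ)

/-- The model with corners over which `T*M` is a manifold. -/
abbrev cotangentModel : ModelWithCorners ℝ (E × (E →L[ℝ] ℝ)) (ModelProd H (E →L[ℝ] ℝ)) :=
  I.prod 𝓘(ℝ, E →L[ℝ] ℝ)

open Classical in
/-- The (maximal local) flow `Φ_t` of a vector field `v`: `flow I v t x` is the value at time `t` of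
an integral curve of `v` that is defined on an open interval containing `0` and `t` and starts
at `x` at time `0`. If there is none, i.e. if `(t, x)` lies outside the flow domain, it has the
junk value `x`. -/
def flow (v : (x : M) → TangentSpace I x) (t : ℝ) (x : M) : M :=
  if h : ∃ γ : ℝ → M, γ 0 = x ∧
      ∃ a b : ℝ, 0 ∈ Ioo a b ∧ t ∈ Ioo a b ∧ IsMIntegralCurveOn γ v (Ioo a b)
  then h.choose t
  else x

theorem flow_zero (v : (x : M) → TangentSpace I x) (x : M) : flow I v 0 x = x := by
  unfold flow
  split_ifs with h
  · exact h.choose_spec.1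
  · rfl

/-- The pullback `φ^* : T*_{φ y} M → T*_y M` of covectors, `⟨φ^* α, w⟩ = ⟨α, T_y φ w⟩`. -/
def pullbackCovector (φ : M → M) (y : M) (α : CotangentSpace I (φ y)) : CotangentSpace I y :=
  α.comp (mfderiv I I φ y)

variable [IsManifold I 1 M]

/-- The cotangent lifted flow `(Φ_{-t})^* : T*M → T*M`, covering `Φ_t`: it sends `⟨q, p⟩` to
`⟨Φ_t q, p ∘ T_{Φ_t q} Φ_{-t}⟩`. The covector `p ∈ T*_q M` is read in the space `T*_{Φ_{-t} (Φ_t q)} M`,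
where `Φ_{-t} (Φ_t q) = q` whenever `(t, q)` is in the flow domain. -/
def cotangentFlow (v : (x : M) → TangentSpace I x) (t : ℝ) (z : CotangentBundle I M) :
    CotangentBundle I M :=
  ⟨flow I v t z.1,
    pullbackCovector I (flow I v (-t)) (flow I v t z.1) (show E →L[ℝ] ℝ from z.2)⟩

theorem cotangentFlow_zero (v : (x : M) → TangentSpace I x) (z : CotangentBundle I M) :
    cotangentFlow I v 0 z = z := by
  have h0 : flow I v (-0 : ℝ) = id := by
    funext x
    rw [neg_zero, flow_zero]
    rfl
  obtain ⟨q, p⟩ := z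
  unfold cotangentFlow
  dsimp only
  rw [flow_zero I v q]
  congr 1
  unfold pullbackCovector
  rw [h0]
  ext w
  simp [mfderiv_id]

/-- The cotangent lift `v̂` of the vector field `v`, a vector field on `T*M`: the infinitesimal
generator `v̂(z) = d/dε|_{ε = 0} (Φ_{-ε})^* z` of the cotangent lifted flow. (At `ε = 0` the curve
is at `cotangentFlow I v 0 z = z`.) -/
def cotangentLift (v : (x : M) → TangentSpace I x) (z : CotangentBundle I M) :
    TangentSpace (cotangentModel I) z :=
  mfderiv 𝓘(ℝ, ℝ) (cotangentModel I) (fun ε : ℝ ↦ cotangentFlow I v ε z) 0 (1 : ℝ)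

/-- The tautological one-form `Θ` on `T*M`: `⟨Θ(q, p), w⟩ = ⟨p, Tπ w⟩`, where `π : T*M → M` is the
projection. -/
def tautologicalForm (z : CotangentBundle I M) :
    TangentSpace (cotangentModel I) z →L[ℝ] ℝ :=
  z.2.comp (mfderiv (cotangentModel I) I
    (TotalSpace.proj : CotangentBundle I M → M) z)

/-- The function `⟨Θ, G⟩` on `T*M`, for a vector field `G` on `T*M`. -/
def thetaPairing (G : (z : CotangentBundle I M) → TangentSpace (cotangentModel I) z)
    (z : CotangentBundle I M) : ℝ :=
  tautologicalForm I z (G z)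

end AdjointSystem

end

/-!
Differentiating the flow `Φ` of `v` in the initial point gives the variational equation
`Ȧ = Dv(Φ) ∘ A`, so the derivative of `Φ_{-ε}` at the moving point `Φ_ε(q)` has velocity `-Dv(q)` at
`ε = 0`. In a chart of `T*M` the cotangent lift of `v` is therefore the Hamiltonian field
`(v, -p ∘ Dv)` of `⟨p, v(q)⟩`, which is smooth, and `v ↦ (v, -p ∘ Dv)` respects brackets because
second derivatives are symmetric. Moreover `⟨Θ, ĝ⟩(q, p) = ⟨p, g(q)⟩` has derivative
`⟨p, [f, g](q)⟩` along the integral curves of `f̂`.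
-/

namespace AdjointSystem

section VariationalEquation

variable {E F : Type*} [NormedAddCommGroup E] [NormedSpace ℝ E]
  [NormedAddCommGroup F] [NormedSpace ℝ F]

theorem gronwallBound_zero_mul (c K ε x : ℝ) :
    gronwallBound 0 K (c * ε) x = c * gronwallBound 0 K ε x := by
  unfold gronwallBound
  split_ifs <;> ring

theorem norm_le_gronwallBound_of_hasDerivAt {f f' : ℝ → F} {K ε t : ℝ} (h0 : f 0 = 0)
    (hf : ∀ s ∈ uIcc 0 t, HasDerivAt f (f' s) s)
    (hb : ∀ s ∈ uIcc 0 t, ‖f' s‖ ≤ K * ‖f s‖ + ε) : ‖f t‖ ≤ gronwallBound 0 K ε |t| := by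
  wlog ht : 0 ≤ t generalizing f f' t
  · have hneg (s : ℝ) (hs : s ∈ uIcc 0 (-t)) : -s ∈ uIcc 0 t := by
      simpa using (neg_mem_neg (s := uIcc 0 (-t))).2 hs
    simpa using this (f := fun s ↦ f (-s)) (f' := fun s ↦ -f' (-s)) (t := -t) (by simpa using h0)
      (fun s hs ↦ ((hf _ (hneg s hs)).scomp s (hasDerivAt_neg s)).congr_deriv (by simp))
      (fun s hs ↦ by simpa using hb _ (hneg s hs)) (by linarith)
  rw [uIcc_of_le ht] at hf hb
  simpa [abs_of_nonneg ht] using norm_le_gronwallBound_of_norm_deriv_right_le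
    (fun s hs ↦ (hf s hs).continuousAt.continuousWithinAt)
    (fun s hs ↦ (hf s (Ico_subset_Icc_self hs)).hasDerivWithinAt) (by simp [h0])
    (fun s hs ↦ hb s (Ico_subset_Icc_self hs)) t (right_mem_Icc.2 ht)

theorem eventually_forall_norm_sub_sub_fderiv_le {v : E → F} {K : Set E} (hK : IsCompact K)
    (hv : ∀ y ∈ K, ContDiffAt ℝ 1 v y) {c : ℝ} (hc : 0 < c) :
    ∀ᶠ h in 𝓝 (0 : E), ∀ y ∈ K, ‖v (y + h) - v y - fderiv ℝ v y h‖ ≤ c * ‖h‖ := by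
  refine hK.eventually_forall_of_forall_eventually fun y₀ hy₀ ↦ ?_
  have hstrict := ((hv y₀ hy₀).hasStrictFDerivAt one_ne_zero).isLittleO.def (half_pos hc)
  have hpair : Filter.Tendsto (fun q : E × E ↦ (q.2 + q.1, q.2)) (𝓝 (0, y₀)) (𝓝 (y₀, y₀)) := by
    have : Continuous fun q : E × E ↦ (q.2 + q.1, q.2) := by fun_prop
    simpa using this.tendsto (0, y₀)
  have hcont : ContinuousAt (fun q : E × E ↦ fderiv ℝ v q.2) (0, y₀) :=
    ContinuousAt.comp (x := ((0, y₀) : E × E)) ((hv y₀ hy₀).continuousAt_fderiv one_ne_zero)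
      continuousAt_snd
  filter_upwards [hpair.eventually hstrict, Metric.continuousAt_iff'.1 hcont _ (half_pos hc)]
    with ⟨h, y⟩ h₁ h₂
  rw [dist_comm, dist_eq_norm] at h₂
  simp only [add_sub_cancel_left] at h₁
  calc ‖v (y + h) - v y - fderiv ℝ v y h‖
      = ‖(v (y + h) - v y - fderiv ℝ v y₀ h) + (fderiv ℝ v y₀ - fderiv ℝ v y) h‖ := by simp
    _ ≤ c / 2 * ‖h‖ + c / 2 * ‖h‖ :=
      norm_add_le_of_le h₁ ((ContinuousLinearMap.le_opNorm _ h).trans (by gcongr))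
    _ = c * ‖h‖ := by ring

theorem hasFDerivAt_uncurry_of_hasDerivAt_of_const {Φ Φ' : ℝ → E → F} {x₀ : E} {a : F}
    (h0 : ∀ᶠ x in 𝓝 x₀, Φ 0 x = a)
    (hΦ : ∀ᶠ q : ℝ × E in 𝓝 (0, x₀), HasDerivAt (Φ · q.2) (Φ' q.1 q.2) q.1)
    (hΦ' : ContinuousAt (Function.uncurry Φ') (0, x₀)) :
    HasFDerivAt (Function.uncurry Φ)
      ((ContinuousLinearMap.fst ℝ ℝ E).smulRight (Φ' 0 x₀)) (0, x₀) := by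
  rw [hasFDerivAt_iff_isLittleO, Asymptotics.isLittleO_iff]
  intro c hc
  have hbox := hΦ.and ((Metric.continuousAt_iff'.1 hΦ' c hc).and
    ((continuous_snd.tendsto ((0 : ℝ), x₀)).eventually h0))
  obtain ⟨η, hη, hball⟩ := Metric.eventually_nhds_iff_ball.1 hbox
  filter_upwards [Metric.ball_mem_nhds _ hη] with ⟨t, x⟩ hq
  simp only [← ball_prod_same, mem_prod] at hq hball
  have hx : ∀ s ∈ Metric.ball (0 : ℝ) η, _ := fun s hs ↦ hball (s, x) ⟨hs, hq.2⟩
  have hmv := (convex_ball (0 : ℝ) η).norm_image_sub_le_of_norm_hasDerivWithin_le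
    (f := fun s ↦ Φ s x - s • Φ' 0 x₀) (C := c)
    (fun s hs ↦ ((hx s hs).1.sub ((hasDerivAt_id s).smul_const _)).hasDerivWithinAt)
    (fun s hs ↦ by simpa [dist_eq_norm] using (hx s hs).2.1.le) (Metric.mem_ball_self hη) hq.1
  have hΦ0 : Φ 0 x = Φ 0 x₀ :=
    (hx 0 (Metric.mem_ball_self hη)).2.2.trans h0.self_of_nhds.symm
  calc ‖Φ t x - Φ 0 x₀ - ((t, x) - ((0 : ℝ), x₀)).1 • Φ' 0 x₀‖
      = ‖(Φ t x - t • Φ' 0 x₀) - (Φ 0 x - (0 : ℝ) • Φ' 0 x₀)‖ := by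
        rw [hΦ0]; congr 1; simp; abel
    _ ≤ c * ‖t - 0‖ := hmv
    _ ≤ c * ‖(t, x) - ((0 : ℝ), x₀)‖ := by
        gcongr; exact norm_fst_le ((t, x) - ((0 : ℝ), x₀))

/-- `Ψ t x`, for `|t| < δ` and `x` in the open set `U`, is a local flow of the field `v` on a
normed space, Lipschitz in the initial point uniformly in time. -/
structure IsLocalFlow (v : E → E) (δ : ℝ) (U : Set E) (Ψ : ℝ → E → E) : Prop where
  isOpen : IsOpen U
  zero_apply : ∀ x ∈ U, Ψ 0 x = x
  hasDerivAt : ∀ t ∈ Ioo (-δ) δ, ∀ x ∈ U, HasDerivAt (Ψ · x) (v (Ψ t x)) t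
  exists_lipschitzOnWith : ∃ C, ∀ t ∈ Ioo (-δ) δ, LipschitzOnWith C (Ψ t) U

theorem IsLocalFlow.mono {v : E → E} {δ δ' : ℝ} {U U' : Set E} {Ψ : ℝ → E → E}
    (h : IsLocalFlow v δ U Ψ) (hδ : δ' ≤ δ) (hU' : IsOpen U') (hU : U' ⊆ U) :
    IsLocalFlow v δ' U' Ψ where
  isOpen := hU'
  zero_apply x hx := h.zero_apply x (hU hx)
  hasDerivAt t ht x hx := h.hasDerivAt t (Ioo_subset_Ioo (neg_le_neg hδ) hδ ht) x (hU hx)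
  exists_lipschitzOnWith :=
    h.exists_lipschitzOnWith.imp fun _ hC t ht ↦
      (hC t (Ioo_subset_Ioo (neg_le_neg hδ) hδ ht)).mono hU

theorem IsLocalFlow.continuousOn_uncurry {v : E → E} {δ : ℝ} {U : Set E} {Ψ : ℝ → E → E}
    (h : IsLocalFlow v δ U Ψ) : ContinuousOn (Function.uncurry Ψ) (Ioo (-δ) δ ×ˢ U) := by
  obtain ⟨C, hC⟩ := h.exists_lipschitzOnWith
  exact continuousOn_prod_of_continuousOn_lipschitzOnWith' _ C hC
    fun x hx t ht ↦ (h.hasDerivAt t ht x hx).continuousAt.continuousWithinAt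

theorem IsLocalFlow.continuousAt_uncurry {v : E → E} {δ : ℝ} {U : Set E} {Ψ : ℝ → E → E}
    (h : IsLocalFlow v δ U Ψ) {t : ℝ} (ht : t ∈ Ioo (-δ) δ) {x : E} (hx : x ∈ U) :
    ContinuousAt (Function.uncurry Ψ) (t, x) :=
  h.continuousOn_uncurry.continuousAt ((isOpen_Ioo.prod h.isOpen).mem_nhds ⟨ht, hx⟩)

theorem exists_isLocalFlow [CompleteSpace E] {v : E → E} {x₀ : E} (hv : ContDiffAt ℝ 1 v x₀)
    {W : Set E} (hW : W ∈ 𝓝 x₀) :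
    ∃ δ > 0, ∃ (U : Set E) (Ψ : ℝ → E → E), x₀ ∈ U ∧ IsLocalFlow v δ U Ψ ∧
      ∀ t ∈ Ioo (-δ) δ, ∀ x ∈ U, Ψ t x ∈ W := by
  obtain ⟨τ, hτ, a, r, L, K, hr, hpl⟩ := IsPicardLindelof.of_contDiffAt_one hv
  obtain ⟨α, hα, C, hC⟩ := (hpl 0).exists_forall_mem_closedBall_eq_hasDerivWithinAt_lipschitzOnWith
  simp only [zero_sub, zero_add] at hα hC
  have hflow : IsLocalFlow v τ (Metric.ball x₀ r) fun t x ↦ α x t :=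
    { isOpen := Metric.isOpen_ball
      zero_apply := fun x hx ↦ (hα x (Metric.ball_subset_closedBall hx)).1
      hasDerivAt := fun t ht x hx ↦ ((hα x (Metric.ball_subset_closedBall hx)).2 t
        (Ioo_subset_Icc_self ht)).hasDerivAt (Icc_mem_nhds ht.1 ht.2)
      exists_lipschitzOnWith := ⟨C, fun t ht ↦
        (hC t (Ioo_subset_Icc_self ht)).mono Metric.ball_subset_closedBall⟩ }
  have hx₀ : x₀ ∈ Metric.ball x₀ r := Metric.mem_ball_self (by exact_mod_cast hr)
  have hmem : ∀ᶠ q : ℝ × E in 𝓝 (0, x₀), α q.2 q.1 ∈ W := by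
    refine (hflow.continuousAt_uncurry ⟨neg_lt_zero.2 hτ, hτ⟩ hx₀).eventually_mem ?_
    simpa [hflow.zero_apply x₀ hx₀] using hW
  obtain ⟨η, hη, hball⟩ := Metric.eventually_nhds_iff_ball.1 hmem
  simp only [← ball_prod_same] at hball
  refine ⟨min τ η, lt_min hτ hη, Metric.ball x₀ r ∩ Metric.ball x₀ η, _,
    ⟨hx₀, Metric.mem_ball_self hη⟩, hflow.mono (min_le_left _ _)
      (Metric.isOpen_ball.inter Metric.isOpen_ball) inter_subset_left, fun t ht x hx ↦ ?_⟩
  refine hball (t, x) ⟨?_, hx.2⟩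
  rw [mem_ball_zero_iff, Real.norm_eq_abs]
  exact (abs_lt.2 ht).trans_le (min_le_right _ _)

/-- The variational equation `ẋ = v(x)`, `Ȧ = Dv(x) ∘ A` of the field `v`, as a field on
`E × (E →L[ℝ] E)`: its flow from `(x, id)` is the flow of `v` and its derivative in `x`. -/
noncomputable def variationalField (v : E → E) (w : E × (E →L[ℝ] E)) : E × (E →L[ℝ] E) :=
  (v w.1, (fderiv ℝ v w.1).comp w.2)

theorem contDiffAt_variationalField {v : E → E} {w : E × (E →L[ℝ] E)}
    (hv : ContDiffAt ℝ 2 v w.1) : ContDiffAt ℝ 1 (variationalField v) w :=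
  ((hv.of_le one_le_two).comp w contDiffAt_fst).prodMk
    (((hv.fderiv_right (m := 1) (by norm_num)).comp w contDiffAt_fst).clm_comp contDiffAt_snd)

theorem norm_sub_sub_le_gronwallBound_of_hasDerivAt {v : E → E} {x y a : ℝ → E} {t K ε : ℝ}
    (hx : ∀ s ∈ uIcc 0 t, HasDerivAt x (v (x s)) s)
    (hy : ∀ s ∈ uIcc 0 t, HasDerivAt y (v (y s)) s)
    (ha : ∀ s ∈ uIcc 0 t, HasDerivAt a (fderiv ℝ v (x s) (a s)) s) (ha0 : a 0 = y 0 - x 0)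
    (hK : ∀ s ∈ uIcc 0 t, ‖fderiv ℝ v (x s)‖ ≤ K)
    (hε : ∀ s ∈ uIcc 0 t, ‖v (y s) - v (x s) - fderiv ℝ v (x s) (y s - x s)‖ ≤ ε) :
    ‖y t - x t - a t‖ ≤ gronwallBound 0 K ε |t| := by
  refine norm_le_gronwallBound_of_hasDerivAt (f := fun s ↦ y s - x s - a s) (by simp [ha0])
    (fun s hs ↦ ((hy s hs).sub (hx s hs)).sub (ha s hs)) fun s hs ↦ ?_
  calc ‖v (y s) - v (x s) - fderiv ℝ v (x s) (a s)‖
      = ‖fderiv ℝ v (x s) (y s - x s - a s) +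
          (v (y s) - v (x s) - fderiv ℝ v (x s) (y s - x s))‖ := by
        rw [map_sub _ (y s - x s)]; congr 1; abel
    _ ≤ K * ‖y s - x s - a s‖ + ε :=
        norm_add_le_of_le (ContinuousLinearMap.le_of_opNorm_le _ (hK s hs) _) (hε s hs)

theorem hasFDerivAt_of_variationalEquation {v : E → E} {Ψ : ℝ → E → E} {A : ℝ → E →L[ℝ] E}
    {U : Set E} {x : E} {t : ℝ} {C : ℝ} (hU : U ∈ 𝓝 x)
    (hΨ0 : ∀ y ∈ U, Ψ 0 y = y) (hA0 : A 0 = ContinuousLinearMap.id ℝ E)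
    (hΨ : ∀ s ∈ uIcc 0 t, ∀ y ∈ U, HasDerivAt (Ψ · y) (v (Ψ s y)) s)
    (hA : ∀ s ∈ uIcc 0 t, HasDerivAt A ((fderiv ℝ v (Ψ s x)).comp (A s)) s)
    (hC : ∀ s ∈ uIcc 0 t, ∀ y ∈ U, ‖Ψ s y - Ψ s x‖ ≤ C * ‖y - x‖)
    (hv : ∀ s ∈ uIcc 0 t, ContDiffAt ℝ 1 v (Ψ s x)) :
    HasFDerivAt (Ψ t) (A t) x := by
  have hxU : x ∈ U := mem_of_mem_nhds hU
  have hcurve : ContinuousOn (Ψ · x) (uIcc 0 t) := fun s hs ↦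
    (hΨ s hs x hxU).continuousAt.continuousWithinAt
  have hcompact : IsCompact ((Ψ · x) '' uIcc 0 t) := isCompact_uIcc.image_of_continuousOn hcurve
  obtain ⟨M, hM⟩ := isCompact_uIcc.exists_bound_of_continuousOn
    (f := fun s ↦ fderiv ℝ v (Ψ s x)) fun s hs ↦
      ((hv s hs).continuousAt_fderiv one_ne_zero).comp_continuousWithinAt (f := (Ψ · x))
        (hcurve s hs)
  set G := gronwallBound 0 M C |t|
  rw [hasFDerivAt_iff_isLittleO, Asymptotics.isLittleO_iff]
  intro ε hε
  have htaylor := eventually_forall_norm_sub_sub_fderiv_le hcompact (forall_mem_image.2 hv)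
    (c := ε / (|G| + 1)) (by positivity)
  obtain ⟨η, hη, htaylor⟩ := Metric.eventually_nhds_iff_ball.1 htaylor
  have hnear : ∀ᶠ y in 𝓝 x, C * ‖y - x‖ < η :=
    ContinuousAt.eventually_lt (f := fun y ↦ C * ‖y - x‖) (by fun_prop) continuousAt_const
      (by simpa using hη)
  filter_upwards [hU, hnear] with y hy hyη
  have hremainder (s) (hs : s ∈ uIcc 0 t) :
      ‖v (Ψ s y) - v (Ψ s x) - fderiv ℝ v (Ψ s x) (Ψ s y - Ψ s x)‖ ≤
        ε / (|G| + 1) * ‖y - x‖ * C := by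
    have hmem : Ψ s y - Ψ s x ∈ Metric.ball 0 η :=
      mem_ball_zero_iff.2 ((hC s hs y hy).trans_lt hyη)
    have h := htaylor _ hmem _ (mem_image_of_mem _ hs)
    rw [add_sub_cancel] at h
    calc _ ≤ ε / (|G| + 1) * (C * ‖y - x‖) := h.trans (by gcongr; exact hC s hs y hy)
      _ = ε / (|G| + 1) * ‖y - x‖ * C := by ring
  calc ‖Ψ t y - Ψ t x - A t (y - x)‖
      ≤ gronwallBound 0 M (ε / (|G| + 1) * ‖y - x‖ * C) |t| :=
        norm_sub_sub_le_gronwallBound_of_hasDerivAt (fun s hs ↦ hΨ s hs x hxU)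
          (fun s hs ↦ hΨ s hs y hy)
          (fun s hs ↦ ((hA s hs).clm_apply (hasDerivAt_const s (y - x))).congr_deriv (by simp))
          (by simp [hΨ0 y hy, hΨ0 x hxU, hA0]) hM hremainder
    _ = ε / (|G| + 1) * ‖y - x‖ * G := gronwallBound_zero_mul ..
    _ ≤ ε / (|G| + 1) * ‖y - x‖ * (|G| + 1) := by gcongr; linarith [le_abs_self G]
    _ = ε * ‖y - x‖ := by field_simp

theorem IsLocalFlow.of_variationalField {v : E → E} {δ : ℝ} {U : Set (E × (E →L[ℝ] E))}
    {Ξ : ℝ → E × (E →L[ℝ] E) → E × (E →L[ℝ] E)} (h : IsLocalFlow (variationalField v) δ U Ξ) :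
    IsLocalFlow v δ {x | (x, .id ℝ E) ∈ U} fun t x ↦ (Ξ t (x, .id ℝ E)).1 where
  isOpen := h.isOpen.preimage (by fun_prop)
  zero_apply _ hx := congrArg Prod.fst (h.zero_apply _ hx)
  hasDerivAt t ht _ hx := (h.hasDerivAt t ht _ hx).fst
  exists_lipschitzOnWith := h.exists_lipschitzOnWith.imp fun C hC t ht ↦
    LipschitzOnWith.of_dist_le_mul fun x hx y hy ↦ by
      simpa [Prod.dist_eq] using (le_max_left _ _).trans ((hC t ht).dist_le_mul _ hx _ hy)

theorem IsLocalFlow.hasFDerivAt_of_variationalField {v : E → E} {δ : ℝ}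
    {U : Set (E × (E →L[ℝ] E))} {Ξ : ℝ → E × (E →L[ℝ] E) → E × (E →L[ℝ] E)}
    (h : IsLocalFlow (variationalField v) δ U Ξ) {t : ℝ} (ht : t ∈ Ioo (-δ) δ) {x : E}
    (hx : (x, .id ℝ E) ∈ U)
    (hv : ∀ s ∈ Ioo (-δ) δ, ContDiffAt ℝ 1 v (Ξ s (x, .id ℝ E)).1) :
    HasFDerivAt (fun y ↦ (Ξ t (y, .id ℝ E)).1) (Ξ t (x, .id ℝ E)).2 x := by
  have hflow := h.of_variationalField
  obtain ⟨C, hC⟩ := hflow.exists_lipschitzOnWith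
  have hsub : uIcc 0 t ⊆ Ioo (-δ) δ :=
    ordConnected_Ioo.uIcc_subset ⟨by linarith [ht.1, ht.2], by linarith [ht.1, ht.2]⟩ ht
  exact hasFDerivAt_of_variationalEquation (A := fun s ↦ (Ξ s (x, .id ℝ E)).2)
    (hflow.isOpen.mem_nhds hx) hflow.zero_apply (congrArg Prod.snd (h.zero_apply _ hx))
    (fun s hs ↦ hflow.hasDerivAt s (hsub hs)) (fun s hs ↦ (h.hasDerivAt s (hsub hs) _ hx).snd)
    (fun s hs y hy ↦ by simpa [dist_eq_norm] using (hC s (hsub hs)).dist_le_mul y hy x hx)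
    (fun s hs ↦ hv s (hsub hs))

theorem IsLocalFlow.hasFDerivAt_snd_of_variationalField {v : E → E} {δ : ℝ} (hδ : 0 < δ)
    {U : Set (E × (E →L[ℝ] E))} {Ξ : ℝ → E × (E →L[ℝ] E) → E × (E →L[ℝ] E)}
    (h : IsLocalFlow (variationalField v) δ U Ξ) {x₀ : E} (hx₀ : (x₀, .id ℝ E) ∈ U)
    (hv : ContDiffAt ℝ 2 v x₀) :
    HasFDerivAt (fun q : ℝ × E ↦ (Ξ q.1 (q.2, .id ℝ E)).2)
      ((ContinuousLinearMap.fst ℝ ℝ E).smulRight (fderiv ℝ v x₀)) (0, x₀) := by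
  have hU := h.of_variationalField.isOpen
  have hd0 : (0 : ℝ) ∈ Ioo (-δ) δ := ⟨neg_lt_zero.2 hδ, hδ⟩
  have hvar : ContinuousAt (variationalField v) (Ξ 0 (x₀, .id ℝ E)) := by
    rw [h.zero_apply _ hx₀]
    exact (contDiffAt_variationalField (w := (x₀, .id ℝ E)) hv).continuousAt
  have hpair : Continuous fun q : ℝ × E ↦ (q.1, q.2, ContinuousLinearMap.id ℝ E) := by fun_prop
  have hcurve : ContinuousAt (fun q : ℝ × E ↦ Ξ q.1 (q.2, .id ℝ E)) (0, x₀) :=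
    (h.continuousAt_uncurry hd0 hx₀).comp (x := ((0 : ℝ), x₀))
      (f := fun q : ℝ × E ↦ (q.1, q.2, ContinuousLinearMap.id ℝ E)) hpair.continuousAt
  have hvarcurve : ContinuousAt (fun q : ℝ × E ↦ variationalField v (Ξ q.1 (q.2, .id ℝ E)))
      (0, x₀) :=
    hvar.comp (x := ((0 : ℝ), x₀)) (f := fun q : ℝ × E ↦ Ξ q.1 (q.2, .id ℝ E)) hcurve
  refine (hasFDerivAt_uncurry_of_hasDerivAt_of_const
    (Φ := fun t x ↦ (Ξ t (x, .id ℝ E)).2)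
    (Φ' := fun t x ↦ (variationalField v (Ξ t (x, .id ℝ E))).2) (a := .id ℝ E)
    (Filter.eventually_of_mem (hU.mem_nhds hx₀)
      fun x hx ↦ congrArg Prod.snd (h.zero_apply _ hx))
    (Filter.eventually_of_mem ((isOpen_Ioo.prod hU).mem_nhds ⟨hd0, hx₀⟩)
      fun q hq ↦ (h.hasDerivAt q.1 hq.1 _ hq.2).snd)
    hvarcurve.snd).congr_fderiv ?_
  rw [h.zero_apply _ hx₀]
  simp [variationalField]

theorem exists_isLocalFlow_hasFDerivAt_fderiv [CompleteSpace E] {v : E → E} {x₀ : E}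
    (hv : ContDiffAt ℝ 2 v x₀) {W : Set E} (hW : W ∈ 𝓝 x₀) :
    ∃ δ > 0, ∃ (U : Set E) (Ψ : ℝ → E → E), x₀ ∈ U ∧ IsLocalFlow v δ U Ψ ∧
      (∀ t ∈ Ioo (-δ) δ, ∀ x ∈ U, Ψ t x ∈ W ∧ DifferentiableAt ℝ (Ψ t) x) ∧
      HasFDerivAt (fun q : ℝ × E ↦ fderiv ℝ (Ψ q.1) q.2)
        ((ContinuousLinearMap.fst ℝ ℝ E).smulRight (fderiv ℝ v x₀)) (0, x₀) := by
  have hreg : {x | x ∈ W ∧ ContDiffAt ℝ 1 v x} ∈ 𝓝 x₀ :=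
    Filter.inter_mem hW ((hv.of_le one_le_two).eventually (by simp))
  have hvar : ContDiffAt ℝ 1 (variationalField v) (x₀, .id ℝ E) := contDiffAt_variationalField hv
  obtain ⟨δ, hδ, U, Ξ, hx₀, hΞ, hΞW⟩ :=
    exists_isLocalFlow hvar (continuousAt_fst.eventually_mem hreg)
  have hderiv (t) (ht : t ∈ Ioo (-δ) δ) (x) (hx : (x, .id ℝ E) ∈ U) :=
    hΞ.hasFDerivAt_of_variationalField ht hx fun s hs ↦ (hΞW s hs _ hx).2
  have hdom := (isOpen_Ioo.prod hΞ.of_variationalField.isOpen).mem_nhds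
    (x := ((0 : ℝ), x₀)) ⟨⟨neg_lt_zero.2 hδ, hδ⟩, hx₀⟩
  refine ⟨δ, hδ, _, _, hx₀, hΞ.of_variationalField,
    fun t ht x hx ↦ ⟨(hΞW t ht _ hx).1, (hderiv t ht x hx).differentiableAt⟩, ?_⟩
  exact (hΞ.hasFDerivAt_snd_of_variationalField hδ hx₀ hv).congr_of_eventuallyEq
    (Filter.eventually_of_mem hdom fun q hq ↦ (hderiv q.1 hq.1 q.2 hq.2).fderiv)

theorem IsLocalFlow.hasDerivAt_fderiv_neg {v : E → E} {δ : ℝ} {U : Set E} {Ψ : ℝ → E → E}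
    (h : IsLocalFlow v δ U Ψ) (hδ : 0 < δ) {x₀ : E} (hx₀ : x₀ ∈ U) {L : E →L[ℝ] E}
    (hΨ : HasFDerivAt (fun q : ℝ × E ↦ fderiv ℝ (Ψ q.1) q.2)
        ((ContinuousLinearMap.fst ℝ ℝ E).smulRight L) (0, x₀)) :
    HasDerivAt (fun t ↦ fderiv ℝ (Ψ (-t)) (Ψ t x₀)) (-L) 0 := by
  have hcurve := (hasDerivAt_neg (0 : ℝ)).prodMk (h.hasDerivAt 0 ⟨neg_lt_zero.2 hδ, hδ⟩ x₀ hx₀)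
  have hpt : (-(0 : ℝ), Ψ 0 x₀) = (0, x₀) := by rw [neg_zero, h.zero_apply x₀ hx₀]
  rw [← hpt] at hΨ
  simpa [Function.comp_def] using hΨ.comp_hasDerivAt (0 : ℝ) hcurve

end VariationalEquation

section HamiltonianField

variable {E : Type*} [NormedAddCommGroup E] [NormedSpace ℝ E]

/-- The Hamiltonian vector field of the function `⟨p, V x⟩` on `E × E*`: the cotangent lift of the
field `V` on `E`. -/
noncomputable def hamiltonianField (V : E → E) (w : E × (E →L[ℝ] ℝ)) : E × (E →L[ℝ] ℝ) :=
  (V w.1, -w.2.comp (fderiv ℝ V w.1))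

theorem hamiltonianField_zero : hamiltonianField (0 : E → E) = 0 := by
  ext w <;> simp [hamiltonianField]

theorem contDiffAt_hamiltonianField {n : WithTop ℕ∞} {V : E → E} {w : E × (E →L[ℝ] ℝ)}
    (hV : ContDiffAt ℝ (n + 1) V w.1) : ContDiffAt ℝ n (hamiltonianField V) w :=
  ((hV.of_le le_self_add).comp w contDiffAt_fst).prodMk
    (contDiffAt_snd.clm_comp ((hV.fderiv_right le_rfl).comp w contDiffAt_fst)).neg

theorem fderiv_hamiltonianField_apply {V : E → E} {w : E × (E →L[ℝ] ℝ)}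
    (hV : ContDiffAt ℝ 2 V w.1) (a : E × (E →L[ℝ] ℝ)) :
    fderiv ℝ (hamiltonianField V) w a = (fderiv ℝ V w.1 a.1,
      -(w.2.comp (fderiv ℝ (fderiv ℝ V) w.1 a.1) + a.2.comp (fderiv ℝ V w.1))) := by
  have hV₁ : HasFDerivAt V (fderiv ℝ V w.1) w.1 := (hV.differentiableAt two_ne_zero).hasFDerivAt
  have hV₂ : HasFDerivAt (fderiv ℝ V) (fderiv ℝ (fderiv ℝ V) w.1) w.1 :=
    ((hV.fderiv_right one_add_one_eq_two.le).differentiableAt one_ne_zero).hasFDerivAt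
  have h : HasFDerivAt (hamiltonianField V) _ w := (hV₁.comp w hasFDerivAt_fst).prodMk
    (hasFDerivAt_snd.clm_comp (hV₂.comp w hasFDerivAt_fst)).neg
  rw [h.fderiv]
  ext u <;> simp

theorem fderiv_lieBracket_apply {V W : E → E} {x : E} (hV : ContDiffAt ℝ 2 V x)
    (hW : ContDiffAt ℝ 2 W x) (u : E) :
    fderiv ℝ (VectorField.lieBracket ℝ V W) x u =
      fderiv ℝ (fderiv ℝ W) x u (V x) + fderiv ℝ W x (fderiv ℝ V x u) -
        (fderiv ℝ (fderiv ℝ V) x u (W x) + fderiv ℝ V x (fderiv ℝ W x u)) := by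
  have hV' := (hV.fderiv_right (m := 1) one_add_one_eq_two.le).differentiableAt one_ne_zero
  have hW' := (hW.fderiv_right (m := 1) one_add_one_eq_two.le).differentiableAt one_ne_zero
  have h : HasFDerivAt (VectorField.lieBracket ℝ V W) _ x :=
    (hW'.hasFDerivAt.clm_apply (hV.differentiableAt two_ne_zero).hasFDerivAt).sub
      (hV'.hasFDerivAt.clm_apply (hW.differentiableAt two_ne_zero).hasFDerivAt)
  rw [h.fderiv]
  simp [add_comm]

theorem lieBracket_hamiltonianField {V W : E → E} {w : E × (E →L[ℝ] ℝ)}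
    (hV : ContDiffAt ℝ 2 V w.1) (hW : ContDiffAt ℝ 2 W w.1) :
    VectorField.lieBracket ℝ (hamiltonianField V) (hamiltonianField W) w =
      hamiltonianField (VectorField.lieBracket ℝ V W) w := by
  have hsymmV := hV.isSymmSndFDerivAt (by simp)
  have hsymmW := hW.isSymmSndFDerivAt (by simp)
  rw [VectorField.lieBracket, fderiv_hamiltonianField_apply hV, fderiv_hamiltonianField_apply hW]
  ext u
  · simp [hamiltonianField, VectorField.lieBracket]
  · simp only [hamiltonianField, ContinuousLinearMap.neg_comp, neg_add_rev, neg_neg,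
      Prod.mk_sub_mk, sub_apply, add_apply, ContinuousLinearMap.comp_apply, neg_apply,
      fderiv_lieBracket_apply hV hW, hsymmW.eq u, hsymmV.eq u, map_sub, map_add, neg_sub]
    abel

theorem hasDerivWithinAt_pairing_of_hamiltonianField {V W : E → E} {c : ℝ → E × (E →L[ℝ] ℝ)}
    {s : Set ℝ} {t : ℝ} (hW : DifferentiableAt ℝ W (c t).1)
    (hc : HasDerivWithinAt c (hamiltonianField V (c t)) s t) :
    HasDerivWithinAt (fun r ↦ (c r).2 (W (c r).1))
      ((c t).2 (VectorField.lieBracket ℝ V W (c t).1)) s t := by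
  have hq : HasDerivWithinAt (fun r ↦ (c r).1) (V (c t).1) s t := hc.fst
  have hp : HasDerivWithinAt (fun r ↦ (c r).2) (-(c t).2.comp (fderiv ℝ V (c t).1)) s t := hc.snd
  refine (hp.clm_apply (hW.hasFDerivAt.comp_hasDerivWithinAt t hq)).congr_deriv ?_
  simp only [Function.comp_apply, neg_apply, ContinuousLinearMap.comp_apply,
    VectorField.lieBracket, map_sub]
  abel

end HamiltonianField

section LocalRep

theorem mlieBracket_modelWithCornersSelf {E : Type*} [NormedAddCommGroup E] [NormedSpace ℝ E]
    (V W : (x : E) → TangentSpace 𝓘(ℝ, E) x) (x : E) :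
    VectorField.mlieBracket 𝓘(ℝ, E) V W x = VectorField.lieBracket ℝ V W x := by
  rw [← VectorField.mlieBracketWithin_univ, VectorField.mlieBracketWithin_eq_lieBracketWithin]
  exact congrFun VectorField.lieBracketWithin_univ x

variable {E : Type*} [NormedAddCommGroup E] [NormedSpace ℝ E]
  {H : Type*} [TopologicalSpace H] (I : ModelWithCorners ℝ E H)
  {M : Type*} [TopologicalSpace M] [ChartedSpace H M]

/-- The representative of the vector field `v` in the preferred chart at `q₀`, with junk values
off the target of that chart. -/
noncomputable def localRep (q₀ : M) (v : (x : M) → TangentSpace I x) : E → E :=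
  VectorField.mpullback 𝓘(ℝ, E) I (extChartAt I q₀).symm v

variable [I.Boundaryless]

theorem mfderivWithin_range_extChartAt_symm_eq (q₀ : M) (x : E) :
    mfderivWithin 𝓘(ℝ, E) I (extChartAt I q₀).symm (range I) x =
      mfderiv 𝓘(ℝ, E) I (extChartAt I q₀).symm x := by
  rw [I.range_eq_univ, mfderivWithin_univ]

variable [IsManifold I 1 M]

theorem mdifferentiableAt_extChartAt_symm {q₀ : M} {x : E} (hx : x ∈ (extChartAt I q₀).target) :
    MDifferentiableAt 𝓘(ℝ, E) I (extChartAt I q₀).symm x := by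
  have h := mdifferentiableWithinAt_extChartAt_symm (I := I) hx
  rwa [I.range_eq_univ, mdifferentiableWithinAt_univ] at h

theorem isInvertible_mfderiv_extChartAt_symm {q₀ : M} {x : E} (hx : x ∈ (extChartAt I q₀).target) :
    (mfderiv 𝓘(ℝ, E) I (extChartAt I q₀).symm x).IsInvertible := by
  rw [← mfderivWithin_range_extChartAt_symm_eq]
  exact isInvertible_mfderivWithin_extChartAt_symm hx

theorem localRep_eq_iff {q₀ : M} {x : E} (hx : x ∈ (extChartAt I q₀).target)
    {v : (x : M) → TangentSpace I x} {w : E} :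
    localRep I q₀ v x = w ↔
      v ((extChartAt I q₀).symm x) = mfderiv 𝓘(ℝ, E) I (extChartAt I q₀).symm x w :=
  (isInvertible_mfderiv_extChartAt_symm I hx).inverse_apply_eq

theorem mfderiv_extChartAt_symm_localRep {q₀ : M} {x : E} (hx : x ∈ (extChartAt I q₀).target)
    (v : (x : M) → TangentSpace I x) :
    mfderiv 𝓘(ℝ, E) I (extChartAt I q₀).symm x (localRep I q₀ v x : E) =
      v ((extChartAt I q₀).symm x) :=
  ((localRep_eq_iff I hx).1 rfl).symm

theorem localRep_extChartAt_self (q₀ : M) (v : (x : M) → TangentSpace I x) :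
    localRep I q₀ v (extChartAt I q₀ q₀) = v q₀ := by
  have h := mfderivWithin_extChartAt_symm_inverse_apply (I := I) (x := q₀)
    (v ((extChartAt I q₀).symm (extChartAt I q₀ q₀)) : E)
  rw [mfderivWithin_range_extChartAt_symm_eq] at h
  refine Eq.trans h ?_
  rw [extChartAt_to_inv]

theorem hasMFDerivAt_extChartAt_symm_comp {q₀ : M} {v : (x : M) → TangentSpace I x} {c : ℝ → E}
    {t : ℝ} (hc : c t ∈ (extChartAt I q₀).target) (h : HasDerivAt c (localRep I q₀ v (c t)) t) :
    HasMFDerivAt 𝓘(ℝ, ℝ) I (fun s ↦ (extChartAt I q₀).symm (c s)) t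
      ((1 : ℝ →L[ℝ] ℝ).smulRight (v ((extChartAt I q₀).symm (c t)))) := by
  refine ((mdifferentiableAt_extChartAt_symm I hc).hasMFDerivAt.comp t
    h.hasFDerivAt.hasMFDerivAt).congr_mfderiv ?_
  refine ContinuousLinearMap.ext_ring ?_
  exact (congrArg _ (one_smul ℝ _)).trans
    ((mfderiv_extChartAt_symm_localRep I hc v).trans (one_smul ℝ _).symm)

end LocalRep

section LocalRepRegularity

variable {E : Type*} [NormedAddCommGroup E] [NormedSpace ℝ E] [CompleteSpace E]
  {H : Type*} [TopologicalSpace H] (I : ModelWithCorners ℝ E H) [I.Boundaryless]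
  {M : Type*} [TopologicalSpace M] [ChartedSpace H M] [IsManifold I ∞ M]

theorem contDiffAt_localRep {n : ℕ∞} {q₀ : M} {x : E}
    (hx : x ∈ (extChartAt I q₀).target) {v : (x : M) → TangentSpace I x} (hv : CMDiff n (T% v)) :
    ContDiffAt ℝ n (localRep I q₀ v) x := by
  refine contMDiffAt_vectorSpace_iff_contDiffAt.1 ?_
  refine ContMDiffAt.mpullback_vectorField_preimage (n := ∞) (hv _) ?_
    (isInvertible_mfderiv_extChartAt_symm I hx) (mod_cast le_top)
  exact (contMDiffOn_extChartAt_symm q₀).contMDiffAt ((isOpen_extChartAt_target q₀).mem_nhds hx)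

theorem contMDiff_of_contDiffAt_localRep {n : ℕ∞} {v : (x : M) → TangentSpace I x}
    (h : ∀ q₀ : M, ContDiffAt ℝ n (localRep I q₀ v) (extChartAt I q₀ q₀)) :
    CMDiff n (T% v) := by
  intro q₀
  have hpull : ContMDiffAt I I.tangent n (fun x ↦ (⟨x, VectorField.mpullback I 𝓘(ℝ, E)
      (extChartAt I q₀) (localRep I q₀ v) x⟩ : TangentBundle I M)) q₀ :=
    ContMDiffAt.mpullback_vectorField_preimage (n := ∞)
      (contMDiffAt_vectorSpace_iff_contDiffAt.2 (h q₀)) contMDiffAt_extChartAt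
      (isInvertible_mfderiv_extChartAt (mem_extChartAt_source q₀)) (mod_cast le_top)
  have hrep := VectorField.eventuallyEq_mpullback_mpullbackWithin_extChartAt (I := I) (s := univ)
    (x := q₀) v
  rw [nhdsWithin_univ, I.range_eq_univ, VectorField.mpullbackWithin_univ] at hrep
  refine hpull.congr_of_eventuallyEq (hrep.mono fun x hx ↦ ?_)
  exact congrArg (TotalSpace.mk x) hx

theorem localRep_mlieBracket {v w : (x : M) → TangentSpace I x}
    (hv : MDiff (T% v)) (hw : MDiff (T% w)) {q₀ : M} {x : E} (hx : x ∈ (extChartAt I q₀).target) :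
    localRep I q₀ (VectorField.mlieBracket I v w) x =
      VectorField.lieBracket ℝ (localRep I q₀ v) (localRep I q₀ w) x := by
  have hmin : minSmoothness ℝ 2 ≤ ∞ := by
    rw [minSmoothness_of_isRCLikeNormedField]
    exact ENat.LEInfty.out
  have : IsManifold I (minSmoothness ℝ 2) M := .of_le hmin
  exact (VectorField.mpullback_mlieBracket (n := ∞) (hv _) (hw _)
    ((contMDiffOn_extChartAt_symm q₀).contMDiffAt ((isOpen_extChartAt_target q₀).mem_nhds hx))
    hmin).trans (mlieBracket_modelWithCornersSelf ..)

end LocalRepRegularity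

section Flow

variable {E : Type*} [NormedAddCommGroup E] [NormedSpace ℝ E]
  {H : Type*} [TopologicalSpace H] (I : ModelWithCorners ℝ E H) [I.Boundaryless]
  {M : Type*} [TopologicalSpace M] [ChartedSpace H M] [IsManifold I 1 M]

theorem mdifferentiableAt_of_comp_extChartAt_symm {q₀ : M} {φ : M → M} {Ψ : E → E} {x : E}
    (hx : x ∈ (extChartAt I q₀).target) (hΨx : Ψ x ∈ (extChartAt I q₀).target)
    (hΨ : DifferentiableAt ℝ Ψ x)
    (hφ : φ ∘ (extChartAt I q₀).symm =ᶠ[𝓝 x] (extChartAt I q₀).symm ∘ Ψ) :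
    MDifferentiableAt I I φ ((extChartAt I q₀).symm x) := by
  have hy : (extChartAt I q₀).symm x ∈ (extChartAt I q₀).source := (extChartAt I q₀).map_target hx
  have hyx : extChartAt I q₀ ((extChartAt I q₀).symm x) = x := (extChartAt I q₀).right_inv hx
  have hchart := mdifferentiableAt_extChartAt (I := I) (by rwa [extChartAt_source] at hy)
  have hcoord : MDifferentiableAt 𝓘(ℝ, E) I ((extChartAt I q₀).symm ∘ Ψ) x :=
    (mdifferentiableAt_extChartAt_symm I hΨx).comp x hΨ.mdifferentiableAt
  refine (MDifferentiableAt.comp_of_eq _ hcoord hchart hyx).congr_of_eventuallyEq ?_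
  have htendsto := continuousAt_extChartAt' (I := I) hy
  rw [ContinuousAt, hyx] at htendsto
  filter_upwards [htendsto.eventually hφ, extChartAt_source_mem_nhds' hy] with y hφy hys
  rw [← (extChartAt I q₀).left_inv hys]
  simpa only [Function.comp_apply, (extChartAt I q₀).left_inv hys] using hφy

theorem mfderiv_comp_mfderiv_extChartAt_symm {q₀ : M} {φ : M → M} {Ψ : E → E} {x : E}
    (hx : x ∈ (extChartAt I q₀).target) (hΨx : Ψ x ∈ (extChartAt I q₀).target)
    (hΨ : DifferentiableAt ℝ Ψ x)
    (hφ : φ ∘ (extChartAt I q₀).symm =ᶠ[𝓝 x] (extChartAt I q₀).symm ∘ Ψ) :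
    (mfderiv I I φ ((extChartAt I q₀).symm x)).comp
        (mfderiv 𝓘(ℝ, E) I (extChartAt I q₀).symm x) =
      (mfderiv 𝓘(ℝ, E) I (extChartAt I q₀).symm (Ψ x) : E →L[ℝ] E).comp (fderiv ℝ Ψ x) := by
  have hφd := mdifferentiableAt_of_comp_extChartAt_symm I hx hΨx hΨ hφ
  have hl := hφd.hasMFDerivAt.comp x (mdifferentiableAt_extChartAt_symm I hx).hasMFDerivAt
  have hr := (mdifferentiableAt_extChartAt_symm I hΨx).hasMFDerivAt.comp x
    hΨ.hasFDerivAt.hasMFDerivAt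
  exact hasMFDerivAt_unique hl (hr.congr_of_eventuallyEq hφ)

theorem isMIntegralCurveOn_extChartAt_symm_comp_localFlow {q₀ : M}
    {v : (x : M) → TangentSpace I x} {δ : ℝ} {U : Set E} {Ψ : ℝ → E → E}
    (h : IsLocalFlow (localRep I q₀ v) δ U Ψ) {x : E}
    (hx : x ∈ U) (htarget : ∀ t ∈ Ioo (-δ) δ, Ψ t x ∈ (extChartAt I q₀).target) :
    IsMIntegralCurveOn (fun t ↦ (extChartAt I q₀).symm (Ψ t x)) v (Ioo (-δ) δ) := fun t ht ↦
  (hasMFDerivAt_extChartAt_symm_comp I (htarget t ht) (h.hasDerivAt t ht x hx)).hasMFDerivWithinAt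

variable [T2Space M]

theorem flow_eq_of_isMIntegralCurveOn {v : (x : M) → TangentSpace I x} (hv : CMDiff 1 (T% v))
    {γ : ℝ → M} {a b t : ℝ} (h₀ : 0 ∈ Ioo a b) (ht : t ∈ Ioo a b)
    (hγ : IsMIntegralCurveOn γ v (Ioo a b)) : flow I v t (γ 0) = γ t := by
  have h : ∃ γ' : ℝ → M, γ' 0 = γ 0 ∧
      ∃ a b : ℝ, 0 ∈ Ioo a b ∧ t ∈ Ioo a b ∧ IsMIntegralCurveOn γ' v (Ioo a b) :=
    ⟨γ, rfl, a, b, h₀, ht, hγ⟩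
  rw [flow, dif_pos h]
  obtain ⟨hstart, c, d, h₀', ht', hγ'⟩ := h.choose_spec
  have hinter : Ioo (max c a) (min d b) = Ioo c d ∩ Ioo a b := Ioo_inter_Ioo.symm
  exact isMIntegralCurveOn_Ioo_eqOn_of_contMDiff_boundaryless (hinter ▸ ⟨h₀', h₀⟩) hv
    (hγ'.mono (hinter ▸ inter_subset_left)) (hγ.mono (hinter ▸ inter_subset_right)) hstart
    (hinter ▸ ⟨ht', ht⟩)

theorem flow_neg_flow_of_isMIntegralCurveOn {v : (x : M) → TangentSpace I x}
    (hv : CMDiff 1 (T% v)) {γ : ℝ → M} {a b t : ℝ} (h₀ : 0 ∈ Ioo a b) (ht : t ∈ Ioo a b)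
    (hγ : IsMIntegralCurveOn γ v (Ioo a b)) : flow I v (-t) (flow I v t (γ 0)) = γ 0 := by
  have hshift : IsMIntegralCurveOn (γ ∘ (· + t)) v (Ioo (a - t) (b - t)) :=
    preimage_add_const_Ioo t a b ▸ hγ.comp_add t
  have hrev := flow_eq_of_isMIntegralCurveOn I hv (t := -t)
    ⟨by linarith [ht.1], by linarith [ht.2]⟩ ⟨by linarith [h₀.1], by linarith [h₀.2]⟩ hshift
  rw [flow_eq_of_isMIntegralCurveOn I hv h₀ ht hγ]
  simpa only [Function.comp_apply, zero_add, neg_add_cancel] using hrev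

theorem mfderiv_flow_zero [CompleteSpace E] {v : (x : M) → TangentSpace I x}
    (hv : CMDiff 1 (T% v)) (x : M) :
    mfderiv 𝓘(ℝ, ℝ) I (fun t ↦ flow I v t x) 0 (1 : ℝ) = v x := by
  obtain ⟨γ, rfl, hγ⟩ := exists_isMIntegralCurveAt_of_contMDiffAt_boundaryless 0 (hv x)
  obtain ⟨ε, hε, hγε⟩ := isMIntegralCurveAt_iff'.1 hγ
  rw [Real.ball_eq_Ioo] at hγε
  have h₀ : (0 : ℝ) ∈ Ioo (0 - ε) (0 + ε) := ⟨by linarith, by linarith⟩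
  have hflow : (fun t ↦ flow I v t (γ 0)) =ᶠ[𝓝 0] γ :=
    (isOpen_Ioo.eventually_mem h₀).mono fun t ht ↦ flow_eq_of_isMIntegralCurveOn I hv h₀ ht hγε
  rw [hflow.mfderiv_eq]
  exact (DFunLike.congr_fun hγ.hasMFDerivAt.mfderiv (1 : ℝ)).trans (one_smul ℝ _)

variable {q₀ : M} {v : (x : M) → TangentSpace I x} {δ : ℝ} {U : Set E} {Ψ : ℝ → E → E}

theorem flow_extChartAt_symm (hv : CMDiff 1 (T% v)) (h : IsLocalFlow (localRep I q₀ v) δ U Ψ)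
    {x : E} (hx : x ∈ U) (htarget : ∀ t ∈ Ioo (-δ) δ, Ψ t x ∈ (extChartAt I q₀).target)
    {t : ℝ} (ht : t ∈ Ioo (-δ) δ) :
    flow I v t ((extChartAt I q₀).symm x) = (extChartAt I q₀).symm (Ψ t x) := by
  have hγ := isMIntegralCurveOn_extChartAt_symm_comp_localFlow I h hx htarget
  simpa only [h.zero_apply x hx] using flow_eq_of_isMIntegralCurveOn I hv
    ⟨by linarith [ht.1, ht.2], by linarith [ht.1, ht.2]⟩ ht hγ

theorem localFlow_neg_localFlow (hv : CMDiff 1 (T% v))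
    (h : IsLocalFlow (localRep I q₀ v) δ U Ψ)
    (htarget : ∀ t ∈ Ioo (-δ) δ, ∀ x ∈ U, Ψ t x ∈ (extChartAt I q₀).target)
    {t : ℝ} (ht : t ∈ Ioo (-δ) δ) {x : E} (hx : x ∈ U) (hxt : Ψ t x ∈ U) :
    Ψ (-t) (Ψ t x) = x := by
  have h₀ : (0 : ℝ) ∈ Ioo (-δ) δ := ⟨by linarith [ht.1, ht.2], by linarith [ht.1, ht.2]⟩
  have hneg : -t ∈ Ioo (-δ) δ := ⟨neg_lt_neg ht.2, neg_lt.1 ht.1⟩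
  have hγ := isMIntegralCurveOn_extChartAt_symm_comp_localFlow I h hx (htarget · · x hx)
  have hrev := flow_neg_flow_of_isMIntegralCurveOn I hv h₀ ht hγ
  simp only [h.zero_apply x hx] at hrev
  rw [flow_extChartAt_symm I hv h hx (htarget · · x hx) ht,
    flow_extChartAt_symm I hv h hxt (htarget · · _ hxt) hneg] at hrev
  exact (extChartAt I q₀).symm.injOn (htarget _ hneg _ hxt)
    (h.zero_apply x hx ▸ htarget 0 h₀ x hx) hrev

end Flow

section CotangentFlow

variable {E : Type*} [NormedAddCommGroup E] [NormedSpace ℝ E]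
  {H : Type*} [TopologicalSpace H] (I : ModelWithCorners ℝ E H)
  {M : Type*} [TopologicalSpace M] [ChartedSpace H M] [IsManifold I 1 M]

theorem mem_extChartAt_cotangent_source_iff {z₀ z : CotangentBundle I M} :
    z ∈ (extChartAt (cotangentModel I) z₀).source ↔ z.1 ∈ (extChartAt I z₀.1).source := by
  rw [extChartAt_source, extChartAt_source, FiberBundle.chartedSpace_chartAt]
  simp only [mfld_simps]
  exact ⟨fun h ↦ h.2, fun h ↦ ⟨⟨h, mem_univ _⟩, h⟩⟩

variable [I.Boundaryless]

theorem extChartAt_cotangent_apply {z₀ z : CotangentBundle I M}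
    (hz : z.1 ∈ (extChartAt I z₀.1).source) :
    extChartAt (cotangentModel I) z₀ z = (extChartAt I z₀.1 z.1, (z.2 : E →L[ℝ] ℝ).comp
      (mfderiv 𝓘(ℝ, E) I (extChartAt I z₀.1).symm (extChartAt I z₀.1 z.1) : E →L[ℝ] E)) := by
  rw [extChartAt_source] at hz
  have hsymm := TangentBundle.symmL_trivializationAt (I := I) hz
  rw [mfderivWithin_range_extChartAt_symm_eq] at hsymm
  rw [extChartAt_coe, Function.comp_apply]
  refine (congrArg _ (hom_chart (E₁ := (TangentSpace I : M → Type _)) z₀ z)).trans ?_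
  refine Prod.ext rfl ?_
  change ContinuousLinearMap.inCoordinates E (TangentSpace I) ℝ (fun _ : M ↦ ℝ)
    z₀.1 z.1 z₀.1 z.1 z.2 = _
  rw [ContinuousLinearMap.inCoordinates, hsymm]
  exact ContinuousLinearMap.ext fun u ↦
    DFunLike.congr_fun (Trivial.continuousLinearMapAt_trivialization ℝ M ℝ z.1) _

theorem fst_mem_extChartAt_target {z₀ : CotangentBundle I M} {w : E × (E →L[ℝ] ℝ)}
    (hw : w ∈ (extChartAt (cotangentModel I) z₀).target) : w.1 ∈ (extChartAt I z₀.1).target := by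
  have hsource := (mem_extChartAt_cotangent_source_iff I).1
    ((extChartAt (cotangentModel I) z₀).map_target hw)
  have hcoord := (extChartAt_cotangent_apply I hsource).symm.trans
    ((extChartAt (cotangentModel I) z₀).right_inv hw)
  rw [← congrArg Prod.fst hcoord]
  exact (extChartAt I z₀.1).map_source hsource

variable {v : (x : M) → TangentSpace I x}

theorem extChartAt_cotangent_snd_localRep {z₀ z : CotangentBundle I M}
    (hz : z ∈ (extChartAt (cotangentModel I) z₀).source) :
    (extChartAt (cotangentModel I) z₀ z).2
      (localRep I z₀.1 v (extChartAt (cotangentModel I) z₀ z).1) = z.2 (v z.1) := by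
  rw [mem_extChartAt_cotangent_source_iff] at hz
  rw [extChartAt_cotangent_apply I hz]
  have hrep := mfderiv_extChartAt_symm_localRep I ((extChartAt I z₀.1).map_source hz) v
  rw [(extChartAt I z₀.1).left_inv hz] at hrep
  exact congrArg (z.2 : E →L[ℝ] ℝ) hrep

variable [T2Space M]

theorem extChartAt_cotangentFlow (hv : CMDiff 1 (T% v)) {z₀ z : CotangentBundle I M}
    (hz : z ∈ (extChartAt (cotangentModel I) z₀).source) {δ : ℝ} {U : Set E} {Ψ : ℝ → E → E}
    (h : IsLocalFlow (localRep I z₀.1 v) δ U Ψ)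
    (hΨ : ∀ t ∈ Ioo (-δ) δ, ∀ x ∈ U, Ψ t x ∈ (extChartAt I z₀.1).target ∧
      DifferentiableAt ℝ (Ψ t) x)
    {t : ℝ} (ht : t ∈ Ioo (-δ) δ) (hzU : extChartAt I z₀.1 z.1 ∈ U)
    (hzt : Ψ t (extChartAt I z₀.1 z.1) ∈ U) :
    cotangentFlow I v t z ∈ (extChartAt (cotangentModel I) z₀).source ∧
    extChartAt (cotangentModel I) z₀ (cotangentFlow I v t z) =
      (Ψ t (extChartAt I z₀.1 z.1), (extChartAt (cotangentModel I) z₀ z).2.comp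
        (fderiv ℝ (Ψ (-t)) (Ψ t (extChartAt I z₀.1 z.1)))) := by
  rw [mem_extChartAt_cotangent_source_iff] at hz
  set x := extChartAt I z₀.1 z.1
  have hzx : (extChartAt I z₀.1).symm x = z.1 := (extChartAt I z₀.1).left_inv hz
  have hneg : -t ∈ Ioo (-δ) δ := ⟨neg_lt_neg ht.2, neg_lt.1 ht.1⟩
  have htarget (s) (hs : s ∈ Ioo (-δ) δ) (y) (hy : y ∈ U) := (hΨ s hs y hy).1
  have hback := localFlow_neg_localFlow I hv h htarget ht hzU hzt
  have hflow := flow_extChartAt_symm I hv h hzU (htarget · · x hzU) ht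
  rw [hzx] at hflow
  have hsource : flow I v t z.1 ∈ (extChartAt I z₀.1).source :=
    hflow ▸ (extChartAt I z₀.1).map_target (htarget t ht x hzU)
  have hcoord : extChartAt I z₀.1 (flow I v t z.1) = Ψ t x :=
    hflow ▸ (extChartAt I z₀.1).right_inv (htarget t ht x hzU)
  have htangent := mfderiv_comp_mfderiv_extChartAt_symm I (φ := flow I v (-t))
    (htarget t ht x hzU) (htarget _ hneg _ hzt) (hΨ _ hneg _ hzt).2 <| by
      filter_upwards [h.isOpen.mem_nhds hzt] with y hy
      exact flow_extChartAt_symm I hv h hy (htarget · · y hy) hneg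
  rw [← hflow, hback, ← hcoord] at htangent
  refine ⟨(mem_extChartAt_cotangent_source_iff I).2 hsource, ?_⟩
  rw [extChartAt_cotangent_apply I (z := cotangentFlow I v t z) hsource,
    extChartAt_cotangent_apply I hz, ← hcoord]
  exact Prod.ext rfl (congrArg (z.2 : E →L[ℝ] ℝ).comp htangent)

end CotangentFlow

section CotangentLift

variable {E : Type*} [NormedAddCommGroup E] [NormedSpace ℝ E] [CompleteSpace E]
  {H : Type*} [TopologicalSpace H] (I : ModelWithCorners ℝ E H) [I.Boundaryless]
  {M : Type*} [TopologicalSpace M] [T2Space M] [ChartedSpace H M] [IsManifold I ∞ M]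
  {v w : (x : M) → TangentSpace I x}

theorem hasDerivAt_extChartAt_cotangentFlow (hv : CMDiff 2 (T% v)) {z₀ z : CotangentBundle I M}
    (hz : z ∈ (extChartAt (cotangentModel I) z₀).source) :
    (∀ᶠ t in 𝓝 (0 : ℝ), cotangentFlow I v t z ∈ (extChartAt (cotangentModel I) z₀).source) ∧
    HasDerivAt (fun t ↦ extChartAt (cotangentModel I) z₀ (cotangentFlow I v t z))
      (hamiltonianField (localRep I z₀.1 v) (extChartAt (cotangentModel I) z₀ z)) 0 := by
  have hz₁ := (mem_extChartAt_cotangent_source_iff I).1 hz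
  have hx : extChartAt I z₀.1 z.1 ∈ (extChartAt I z₀.1).target := (extChartAt I z₀.1).map_source hz₁
  obtain ⟨δ, hδ, U, Ψ, hxU, hΨ, hreg, hfderiv⟩ :=
    exists_isLocalFlow_hasFDerivAt_fderiv (contDiffAt_localRep I (n := 2) hx hv)
      ((isOpen_extChartAt_target z₀.1).mem_nhds hx)
  have h₀ : (0 : ℝ) ∈ Ioo (-δ) δ := ⟨neg_lt_zero.2 hδ, hδ⟩
  have hcurve := hΨ.hasDerivAt 0 h₀ _ hxU
  rw [hΨ.zero_apply _ hxU] at hcurve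
  have hU : ∀ᶠ t in 𝓝 0, Ψ t (extChartAt I z₀.1 z.1) ∈ U :=
    hcurve.continuousAt.eventually_mem ((hΨ.zero_apply _ hxU).symm ▸ hΨ.isOpen.mem_nhds hxU)
  have hcoord := (isOpen_Ioo.eventually_mem h₀ |>.and hU).mono fun t ht ↦
    extChartAt_cotangentFlow I (hv.of_le one_le_two) hz hΨ hreg ht.1 hxU ht.2
  refine ⟨hcoord.mono fun t ht ↦ ht.1, ?_⟩
  set p := (extChartAt (cotangentModel I) z₀ z).2
  have hfst : (extChartAt (cotangentModel I) z₀ z).1 = extChartAt I z₀.1 z.1 :=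
    congrArg Prod.fst (extChartAt_cotangent_apply I hz₁)
  have hmomentum := (ContinuousLinearMap.compL ℝ E E ℝ p).hasFDerivAt.comp_hasDerivAt 0
    (hΨ.hasDerivAt_fderiv_neg hδ hxU hfderiv)
  refine ((hcurve.prodMk hmomentum).congr_of_eventuallyEq
    (hcoord.mono fun t ht ↦ ht.2)).congr_deriv ?_
  simp only [hamiltonianField, hfst, ContinuousLinearMap.compL_apply,
    ContinuousLinearMap.comp_neg, p]

theorem hasMFDerivAt_cotangentFlow (hv : CMDiff 2 (T% v)) {z₀ : CotangentBundle I M}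
    {a : E × (E →L[ℝ] ℝ)} (ha : a ∈ (extChartAt (cotangentModel I) z₀).target) :
    HasMFDerivAt 𝓘(ℝ, ℝ) (cotangentModel I)
      (fun t ↦ cotangentFlow I v t ((extChartAt (cotangentModel I) z₀).symm a)) 0
      ((1 : ℝ →L[ℝ] ℝ).smulRight
        (mfderiv 𝓘(ℝ, E × (E →L[ℝ] ℝ)) (cotangentModel I) (extChartAt (cotangentModel I) z₀).symm a
          (hamiltonianField (localRep I z₀.1 v) a) : E × (E →L[ℝ] ℝ))) := by
  have hright := (extChartAt (cotangentModel I) z₀).right_inv ha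
  obtain ⟨hmem, hderiv⟩ := hasDerivAt_extChartAt_cotangentFlow I hv
    ((extChartAt (cotangentModel I) z₀).map_target ha)
  have hstart : extChartAt (cotangentModel I) z₀ (cotangentFlow I v 0
      ((extChartAt (cotangentModel I) z₀).symm a)) = a := by
    rw [cotangentFlow_zero, hright]
  have hsymm := mdifferentiableAt_extChartAt_symm (cotangentModel I) (hstart.symm ▸ ha)
  have hflow := (hsymm.hasMFDerivAt.comp (0 : ℝ)
    hderiv.hasFDerivAt.hasMFDerivAt).congr_of_eventuallyEq
    (hmem.mono fun t ht ↦ ((extChartAt (cotangentModel I) z₀).left_inv ht).symm)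
  refine hflow.congr_mfderiv (ContinuousLinearMap.ext_ring ?_)
  rw [hstart, hright]
  exact (congrArg _ (one_smul ℝ _)).trans (one_smul ℝ _).symm

theorem mdifferentiableAt_cotangentFlow (hv : CMDiff 2 (T% v)) (z : CotangentBundle I M) :
    MDifferentiableAt 𝓘(ℝ, ℝ) (cotangentModel I) (fun t ↦ cotangentFlow I v t z) 0 := by
  have h := hasMFDerivAt_cotangentFlow I hv (mem_extChartAt_target z)
  rw [extChartAt_to_inv] at h
  exact h.mdifferentiableAt

theorem localRep_cotangentLift (hv : CMDiff 2 (T% v)) {z₀ : CotangentBundle I M}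
    {a : E × (E →L[ℝ] ℝ)} (ha : a ∈ (extChartAt (cotangentModel I) z₀).target) :
    localRep (cotangentModel I) z₀ (cotangentLift I v) a =
      hamiltonianField (localRep I z₀.1 v) a :=
  (localRep_eq_iff (cotangentModel I) ha).2 <|
    (DFunLike.congr_fun (hasMFDerivAt_cotangentFlow I hv ha).mfderiv (1 : ℝ)).trans (one_smul ℝ _)

theorem eventuallyEq_localRep_cotangentLift (hv : CMDiff 2 (T% v)) {z₀ : CotangentBundle I M}
    {a : E × (E →L[ℝ] ℝ)} (ha : a ∈ (extChartAt (cotangentModel I) z₀).target) :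
    localRep (cotangentModel I) z₀ (cotangentLift I v) =ᶠ[𝓝 a]
      hamiltonianField (localRep I z₀.1 v) :=
  Filter.eventuallyEq_of_mem ((isOpen_extChartAt_target z₀).mem_nhds ha)
    fun _ hb ↦ localRep_cotangentLift I hv hb

theorem contMDiff_cotangentLift {k : ℕ∞} (hk : 1 ≤ k)
    (hv : CMDiff (k + 1) (T% v)) :
    ContMDiff (cotangentModel I) (cotangentModel I).tangent k (fun z ↦ (⟨z, cotangentLift I v z⟩ :
      TangentBundle (cotangentModel I) (CotangentBundle I M))) := by
  refine contMDiff_of_contDiffAt_localRep (cotangentModel I) fun z₀ ↦ ?_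
  have hz₀ := mem_extChartAt_target (I := cotangentModel I) z₀
  have hv₂ : CMDiff 2 (T% v) :=
    hv.of_le (one_add_one_eq_two.symm.trans_le (add_le_add_left (mod_cast hk) 1))
  refine (contDiffAt_hamiltonianField ?_).congr_of_eventuallyEq
    (eventuallyEq_localRep_cotangentLift I hv₂ hz₀)
  exact contDiffAt_localRep I (n := k + 1) (fst_mem_extChartAt_target I hz₀) hv

theorem mlieBracket_cotangentLift (hv : CMDiff 2 (T% v)) (hw : CMDiff 2 (T% w))
    (hvw : CMDiff 2 (T% (VectorField.mlieBracket I v w))) (z : CotangentBundle I M) :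
    VectorField.mlieBracket (cotangentModel I) (cotangentLift I v) (cotangentLift I w) z =
      cotangentLift I (VectorField.mlieBracket I v w) z := by
  set V := localRep I z.1 v
  set W := localRep I z.1 w
  set a := extChartAt (cotangentModel I) z z
  have ha : a ∈ (extChartAt (cotangentModel I) z).target := mem_extChartAt_target z
  have ha₁ := fst_mem_extChartAt_target I ha
  have hbracket : localRep I z.1 (VectorField.mlieBracket I v w) =ᶠ[𝓝 a.1]
      VectorField.lieBracket ℝ V W :=
    Filter.eventuallyEq_of_mem ((isOpen_extChartAt_target z.1).mem_nhds ha₁)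
      fun x hx ↦ localRep_mlieBracket I (hv.mdifferentiable two_ne_zero)
        (hw.mdifferentiable two_ne_zero) hx
  refine (localRep_extChartAt_self (cotangentModel I) z _).symm.trans
    (Eq.trans ?_ (localRep_extChartAt_self (cotangentModel I) z _))
  calc localRep (cotangentModel I) z (VectorField.mlieBracket (cotangentModel I)
          (cotangentLift I v) (cotangentLift I w)) a
      = VectorField.lieBracket ℝ (hamiltonianField V) (hamiltonianField W) a := by
        rw [← (eventuallyEq_localRep_cotangentLift I hv ha).lieBracket_vectorField_eq
          (eventuallyEq_localRep_cotangentLift I hw ha)]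
        exact localRep_mlieBracket (cotangentModel I)
          ((contMDiff_cotangentLift I le_rfl hv).mdifferentiable one_ne_zero)
          ((contMDiff_cotangentLift I le_rfl hw).mdifferentiable one_ne_zero) ha
    _ = hamiltonianField (VectorField.lieBracket ℝ V W) a :=
        lieBracket_hamiltonianField (contDiffAt_localRep I (n := 2) ha₁ hv)
          (contDiffAt_localRep I (n := 2) ha₁ hw)
    _ = hamiltonianField (localRep I z.1 (VectorField.mlieBracket I v w)) a := by
        rw [hamiltonianField, hamiltonianField, hbracket.eq_of_nhds, hbracket.fderiv_eq]
    _ = localRep (cotangentModel I) z (cotangentLift I (VectorField.mlieBracket I v w)) a :=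
        (localRep_cotangentLift I hvw ha).symm

theorem cotangentLift_zero (z : CotangentBundle I M) :
    cotangentLift I (0 : (x : M) → TangentSpace I x) z = 0 := by
  have hz := mem_extChartAt_target (I := cotangentModel I) z
  have hsmooth : CMDiff 2 (T% (0 : (x : M) → TangentSpace I x)) :=
    contMDiff_zeroSection ℝ (TangentSpace I : M → Type _)
  rw [← localRep_extChartAt_self (cotangentModel I) z (cotangentLift I 0),
    localRep_cotangentLift I hsmooth hz, localRep, VectorField.mpullback_zero]
  exact congrFun hamiltonianField_zero _

end CotangentLift

section ThetaPairing

variable {E : Type*} [NormedAddCommGroup E] [NormedSpace ℝ E] [CompleteSpace E]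
  {H : Type*} [TopologicalSpace H] (I : ModelWithCorners ℝ E H) [I.Boundaryless]
  {M : Type*} [TopologicalSpace M] [T2Space M] [ChartedSpace H M] [IsManifold I ∞ M]
  {f g v : (x : M) → TangentSpace I x}

theorem mfderiv_proj_cotangentLift (hv : CMDiff 2 (T% v)) (z : CotangentBundle I M) :
    mfderiv (cotangentModel I) I (TotalSpace.proj : CotangentBundle I M → M) z
      (cotangentLift I v z) = v z.1 := by
  have hproj : MDifferentiableAt (cotangentModel I) I (TotalSpace.proj : CotangentBundle I M → M)
      (cotangentFlow I v 0 z) :=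
    (contMDiff_proj (n := 1) _).mdifferentiableAt one_ne_zero
  have hcomp := mfderiv_comp_apply 0 hproj (mdifferentiableAt_cotangentFlow I hv z) (1 : ℝ)
  rw [cotangentFlow_zero] at hcomp
  exact hcomp.symm.trans (mfderiv_flow_zero I (hv.of_le one_le_two) z.1)

theorem thetaPairing_cotangentLift (hv : CMDiff 2 (T% v)) (z : CotangentBundle I M) :
    thetaPairing I (cotangentLift I v) z = z.2 (v z.1) :=
  congrArg z.2 (mfderiv_proj_cotangentLift I hv z)

theorem hasDerivWithinAt_extChartAt_of_isMIntegralCurveOn (hf : CMDiff 2 (T% f))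
    {γ : ℝ → CotangentBundle I M} {s : Set ℝ} (hγ : IsMIntegralCurveOn γ (cotangentLift I f) s)
    {t : ℝ} (ht : t ∈ s) :
    HasDerivWithinAt (fun r ↦ extChartAt (cotangentModel I) (γ t) (γ r))
      (hamiltonianField (localRep I (γ t).1 f) (extChartAt (cotangentModel I) (γ t) (γ t)))
      s t := by
  have hsource := mem_extChartAt_source (I := cotangentModel I) (γ t)
  rw [← localRep_cotangentLift I hf (mem_extChartAt_target (γ t)), localRep_extChartAt_self]
  exact (hγ.hasDerivWithinAt ht hsource).congr_deriv (tangentCoordChange_self hsource)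

theorem hasDerivWithinAt_pairing_of_isMIntegralCurveOn (hf : CMDiff 2 (T% f))
    (hg : CMDiff 1 (T% g))
    {γ : ℝ → CotangentBundle I M} {s : Set ℝ} (hγ : IsMIntegralCurveOn γ (cotangentLift I f) s)
    {t : ℝ} (ht : t ∈ s) :
    HasDerivWithinAt (fun r ↦ (γ r).2 (g (γ r).1))
      ((γ t).2 (VectorField.mlieBracket I f g (γ t).1)) s t := by
  have hsource := mem_extChartAt_source (I := cotangentModel I) (γ t)
  have htarget := fst_mem_extChartAt_target I (mem_extChartAt_target (γ t))
  have hpair := hasDerivWithinAt_pairing_of_hamiltonianField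
    ((contDiffAt_localRep I (n := 1) htarget hg).differentiableAt one_ne_zero)
    (hasDerivWithinAt_extChartAt_of_isMIntegralCurveOn I hf hγ ht)
  rw [← localRep_mlieBracket I (hf.mdifferentiable two_ne_zero) (hg.mdifferentiable one_ne_zero)
    htarget, extChartAt_cotangent_snd_localRep I hsource] at hpair
  refine hpair.congr_of_eventuallyEq ?_ (extChartAt_cotangent_snd_localRep I hsource).symm
  filter_upwards [(hγ t ht).1.preimage_mem_nhdsWithin
    (extChartAt_source_mem_nhds (I := cotangentModel I) (γ t))] with r hr
  exact (extChartAt_cotangent_snd_localRep I hr).symm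

theorem thetaPairing_cotangentLift_eq_of_isMIntegralCurveOn (hf : CMDiff 2 (T% f))
    (hg : CMDiff 2 (T% g)) (hgf : VectorField.mlieBracket I g f = 0)
    {γ : ℝ → CotangentBundle I M} {s : Set ℝ} (hs : s.OrdConnected)
    (hγ : IsMIntegralCurveOn γ (cotangentLift I f) s) {t₁ t₂ : ℝ} (ht₁ : t₁ ∈ s) (ht₂ : t₂ ∈ s) :
    thetaPairing I (cotangentLift I g) (γ t₁) = thetaPairing I (cotangentLift I g) (γ t₂) := by
  have hfg : VectorField.mlieBracket I f g = 0 := by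
    rw [VectorField.mlieBracket_swap, hgf, neg_zero]
  have hderiv (t) (ht : t ∈ s) : HasDerivWithinAt (fun r ↦ (γ r).2 (g (γ r).1)) 0 s t := by
    refine (hasDerivWithinAt_pairing_of_isMIntegralCurveOn I hf (hg.of_le one_le_two)
      hγ ht).congr_deriv ?_
    rw [hfg]
    exact map_zero _
  have hbound := hs.convex.norm_image_sub_le_of_norm_hasDerivWithin_le (C := 0) hderiv
    (fun _ _ ↦ norm_zero.le) ht₂ ht₁
  rw [thetaPairing_cotangentLift I hg, thetaPairing_cotangentLift I hg]
  rwa [zero_mul, norm_le_zero_iff, sub_eq_zero] at hbound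

end ThetaPairing

end AdjointSystem

open AdjointSystem in
theorem mainTheorem11_general
    {E : Type*} [NormedAddCommGroup E] [NormedSpace ℝ E] [CompleteSpace E]
    {H : Type*} [TopologicalSpace H] (I : ModelWithCorners ℝ E H) [I.Boundaryless]
    {M : Type*} [TopologicalSpace M] [T2Space M] [ChartedSpace H M] [IsManifold I ∞ M]
    {k : ℕ∞} (hk : 1 ≤ k) (f g : (x : M) → TangentSpace I x)
    (hf : CMDiff 2 (T% f)) (hg : CMDiff (k + 1) (T% g))
    (hgf : ∀ x, VectorField.mlieBracket I g f x = 0) :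
    ContMDiff (cotangentModel I) (cotangentModel I).tangent k
        (fun z ↦ (⟨z, cotangentLift I g z⟩ :
          TangentBundle (cotangentModel I) (CotangentBundle I M))) ∧
      (∀ z : CotangentBundle I M,
        VectorField.mlieBracket (cotangentModel I) (cotangentLift I g) (cotangentLift I f) z = 0) ∧
      (∀ (γ : ℝ → CotangentBundle I M) (s : Set ℝ), s.OrdConnected →
        IsMIntegralCurveOn γ (cotangentLift I f) s → ∀ t₁ ∈ s, ∀ t₂ ∈ s,
          thetaPairing I (cotangentLift I g) (γ t₁) =
            thetaPairing I (cotangentLift I g) (γ t₂)) := by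
  have hg₂ : CMDiff 2 (T% g) :=
    hg.of_le (one_add_one_eq_two.symm.trans_le (add_le_add_left (mod_cast hk) 1))
  have hgf₀ : VectorField.mlieBracket I g f = 0 := funext hgf
  refine ⟨contMDiff_cotangentLift I hk hg, fun z ↦ ?_, fun γ s hs hγ t₁ ht₁ t₂ ht₂ ↦
    thetaPairing_cotangentLift_eq_of_isMIntegralCurveOn I hf hg₂ hgf₀ hs hγ ht₁ ht₂⟩
  rw [mlieBracket_cotangentLift I hg₂ hf, hgf₀, cotangentLift_zero]
  exact hgf₀ ▸ contMDiff_zeroSection ℝ (TangentSpace I : M → Type _)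

theorem mainTheorem11
    {E : Type*} [NormedAddCommGroup E] [NormedSpace ℝ E] [FiniteDimensional ℝ E]
    {H : Type*} [TopologicalSpace H] (I : ModelWithCorners ℝ E H) [I.Boundaryless]
    {M : Type*} [TopologicalSpace M] [T2Space M] [ChartedSpace H M] [IsManifold I ∞ M]
    (f g : (x : M) → TangentSpace I x)
    (hf : ContMDiff I I.tangent ∞ (fun x ↦ (⟨x, f x⟩ : TangentBundle I M)))
    (hg : ContMDiff I I.tangent ∞ (fun x ↦ (⟨x, g x⟩ : TangentBundle I M)))
    (hgf : ∀ x, VectorField.mlieBracket I g f x = 0) :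
    ContMDiff (AdjointSystem.cotangentModel I) (AdjointSystem.cotangentModel I).tangent ∞
        (fun z ↦ (⟨z, AdjointSystem.cotangentLift I g z⟩ :
          TangentBundle (AdjointSystem.cotangentModel I) (AdjointSystem.CotangentBundle I M))) ∧
      (∀ z : AdjointSystem.CotangentBundle I M,
        VectorField.mlieBracket (AdjointSystem.cotangentModel I)
          (AdjointSystem.cotangentLift I g) (AdjointSystem.cotangentLift I f) z = 0) ∧
      (∀ (γ : ℝ → AdjointSystem.CotangentBundle I M) (s : Set ℝ), s.OrdConnected →
        IsMIntegralCurveOn γ (AdjointSystem.cotangentLift I f) s →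
        ∀ t₁ ∈ s, ∀ t₂ ∈ s,
          AdjointSystem.thetaPairing I (AdjointSystem.cotangentLift I g) (γ t₁) =
            AdjointSystem.thetaPairing I (AdjointSystem.cotangentLift I g) (γ t₂)) := by
  have : CompleteSpace E := FiniteDimensional.complete ℝ E
  exact mainTheorem11_general I (k := ⊤) le_top f g (hf.of_le ENat.LEInfty.out) hg hgf
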